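/- Let $m,n$ be natural numbers, let $\mathbb{P}_m$ be the set of $m\times m$ complex (Hermitian) positive definite matrices, let $A_1,\dots,A_n\in\mathbb{P}_m$, and let $\omega=(w_1,\dots,w_n)$ be a positive probability vector, i.e. $w_j>0$ for all $j$ and $\sum_{j=1}^n w_j=1$. For $A,B\in\mathbb{P}_m$ let $$d(A,B)=\left[\operatorname{Tr}\left(\frac{A+B}{2}\right)-\operatorname{Tr}\left(A^{1/2}BA^{1/2}\right)^{1/2}\right]^{1/2}$$ be the Wasserstein metric. Then the function $X\mapsto\sum_{j=1}^n w_j\,d(X,A_j)^2$ has a unique minimizer over $X\in\mathbb{P}_m$, the Wasserstein mean $$\Omega(\omega;A_1,\dots,A_n)=\underset{X\in\mathbb{P}_m}{\arg\min}\ \sum_{j=1}^n w_j\,d(X,A_j)^2,$$ and it satisfies $$\Omega(\omega;A_1,\dots,A_n)\ \ge\ 2I-\sum_{j=1}^n w_jA_j^{-1},$$ where $X\ge Y$ means that $X-Y$ is positive semidefinite. -/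

import Mathlib

open scoped ComplexOrder MatrixOrder

/-- The Wasserstein (Bures) distance of positive definite complex matrices,
`d(A, B) = [Tr((A + B)/2) - Tr((A^{1/2} B A^{1/2})^{1/2})]^{1/2}`.
The traces are real for positive definite `A`, `B`; `CFC.sqrt` is the positive semidefinite
square root. -/
noncomputable def wassersteinDist {m : ℕ} (A B : Matrix (Fin m) (Fin m) ℂ) : ℝ :=
  Real.sqrt ((((1 / 2 : ℂ) • (A + B)).trace).re
    - ((CFC.sqrt (CFC.sqrt A * B * CFC.sqrt A)).trace).re)

/-- The weighted least squares objective `X ↦ ∑ j, w j * d(X, A j) ^ 2`. -/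
noncomputable def wassersteinObjective {m n : ℕ} (w : Fin n → ℝ)
    (A : Fin n → Matrix (Fin m) (Fin m) ℂ) (X : Matrix (Fin m) (Fin m) ℂ) : ℝ :=
  ∑ j, w j * wassersteinDist X (A j) ^ 2

/-- `X` minimizes the least squares objective over the positive definite matrices. -/
def IsWassersteinMean {m n : ℕ} (w : Fin n → ℝ)
    (A : Fin n → Matrix (Fin m) (Fin m) ℂ) (X : Matrix (Fin m) (Fin m) ℂ) : Prop :=
  X.PosDef ∧ ∀ Y : Matrix (Fin m) (Fin m) ℂ, Y.PosDef →
    wassersteinObjective w A X ≤ wassersteinObjective w A Y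

open Classical in
/-- The Wasserstein mean `Ω(w; A)`: the minimizer of the least squares objective over the positive
definite matrices (and `0` if there were none). -/
noncomputable def wassersteinMean {m n : ℕ} (w : Fin n → ℝ)
    (A : Fin n → Matrix (Fin m) (Fin m) ℂ) : Matrix (Fin m) (Fin m) ℂ :=
  if h : ∃ X, IsWassersteinMean w A X then h.choose else 0

/-!
The Wasserstein mean is found through duality, which avoids differentiating matrix square roots.

For positive definite `X`, `A`, `T` put `S = X^{1/2} T X^{1/2}` and
`R = (X^{1/2} A X^{1/2})^{1/2}`. Then
`tr (T X) + tr (T⁻¹ A) - 2 tr R = tr ((S - R) S⁻¹ (S - R)) ≥ 0`, with equality exactly when `S = R`,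
that is when `T X T = A` (`Matrix.trace_mul_add_trace_inv_mul_sub`, `Matrix.defect_eq_zero_iff`).
So every `T` yields an affine minorant of `X ↦ d(X, A)²`, which touches it exactly where
`T X T = A` (`le_wassersteinDist_sq`, `eq_wassersteinDist_sq_iff`).

Suppose that positive definite `T j` and `X` satisfy `∑ j, w j • T j = 1` and `T j * X * T j = A j`.
The weighted sum of the minorants for the `T j` is then constant in the variable, equals the
objective at `X`, and equals it nowhere else; so `X` is the unique minimizer
(`isWassersteinMean_iff_eq`).

Such `T j` and `X` exist (`exists_critical_point`): minimize `∑ j, w j * tr ((T j)⁻¹ * A j)` subject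
to `∑ j, w j • T j = 1`. The constraint bounds the `T j`, a bound on the functional bounds the
`(T j)⁻¹`, so a minimizer exists (`exists_min_sum_trace_inv_mul`). The first-order condition says
that `(T j)⁻¹ * A j * (T j)⁻¹` does not depend on `j`, and this common matrix is `X`.

Finally `(T j)⁻¹` is the geometric mean of `(A j)⁻¹` and `X`, whence
`(A j)⁻¹ + X ≥ 2 • (T j)⁻¹ ≥ 2 • (2 - T j)`. Averaging over `j` gives
`∑ j, w j • (A j)⁻¹ + X ≥ 2`, the asserted bound (`two_sub_sum_inv_le`).
-/

/-! ### The defect in the variational formula for the trace of the square root -/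

namespace Matrix

variable {m : Type*} [Fintype m]

theorem PosSemidef.trace_re_nonneg {P : Matrix m m ℂ} (hP : P.PosSemidef) : 0 ≤ P.trace.re :=
  (Complex.le_def.1 hP.trace_nonneg).1

theorem PosSemidef.trace_re_eq_zero_iff {P : Matrix m m ℂ} (hP : P.PosSemidef) :
    P.trace.re = 0 ↔ P = 0 := by
  rw [← hP.trace_eq_zero_iff]
  refine ⟨fun h => Complex.ext h ?_, fun h => by rw [h]; rfl⟩
  exact (Complex.le_def.1 hP.trace_nonneg).2.symm

theorem IsHermitian.posSemidef_mul_mul_self {P Q : Matrix m m ℂ} (hP : P.IsHermitian)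
    (hQ : Q.PosSemidef) : (P * Q * P).PosSemidef := by
  have h := hQ.mul_mul_conjTranspose_same P
  rwa [hP.eq] at h

variable [DecidableEq m]

theorem PosSemidef.trace_mul_re_nonneg {P Q : Matrix m m ℂ} (hP : P.PosSemidef)
    (hQ : Q.PosSemidef) : 0 ≤ (P * Q).trace.re := by
  have hs : (CFC.sqrt P).PosSemidef := nonneg_iff_posSemidef.1 (CFC.sqrt_nonneg P)
  have h := (hQ.mul_mul_conjTranspose_same (CFC.sqrt P)).trace_re_nonneg
  rwa [hs.isHermitian.eq, trace_mul_cycle,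
    CFC.sqrt_mul_sqrt_self P (nonneg_iff_posSemidef.2 hP)] at h

theorem PosDef.posDef_sqrt {P : Matrix m m ℂ} (hP : P.PosDef) : (CFC.sqrt P).PosDef :=
  isStrictlyPositive_iff_posDef.1 (IsStrictlyPositive.sqrt P (isStrictlyPositive_iff_posDef.2 hP))

theorem PosDef.posDef_mul_mul_self {P Q : Matrix m m ℂ} (hP : P.PosDef) (hQ : Q.PosDef) :
    (P * Q * P).PosDef := by
  have h := (IsUnit.posDef_star_right_conjugate_iff (x := Q) hP.isUnit).2 hQ
  rwa [star_eq_conjTranspose, hP.isHermitian.eq] at h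

theorem PosDef.mul_inv_cancel {P : Matrix m m ℂ} (hP : P.PosDef) : P * P⁻¹ = 1 :=
  mul_nonsing_inv P ((isUnit_iff_isUnit_det P).1 hP.isUnit)

theorem PosDef.inv_mul_cancel {P : Matrix m m ℂ} (hP : P.PosDef) : P⁻¹ * P = 1 :=
  nonsing_inv_mul P ((isUnit_iff_isUnit_det P).1 hP.isUnit)

theorem IsHermitian.mul_mul_self_eq_zero_iff {D P : Matrix m m ℂ} (hD : D.IsHermitian)
    (hP : P.PosDef) : D * P * D = 0 ↔ D = 0 := by
  refine ⟨fun h => ?_, fun h => by rw [h, mul_zero]⟩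
  have hr := hP.posDef_sqrt
  rw [← CFC.sqrt_mul_sqrt_self P (nonneg_iff_posSemidef.2 hP.posSemidef)] at h
  have h1 : (D * CFC.sqrt P) * (D * CFC.sqrt P)ᴴ = 0 := by
    rw [conjTranspose_mul, hr.isHermitian.eq, hD.eq, ← h]
    simp only [mul_assoc]
  exact hr.isUnit.mul_left_eq_zero.1 (self_mul_conjTranspose_eq_zero.1 h1)

theorem sub_mul_inv_mul_sub {S R : Matrix m m ℂ} (hS : S.PosDef) :
    (S - R) * S⁻¹ * (S - R) = S - R - R + R * S⁻¹ * R := by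
  have h1 : R * S⁻¹ * S = R := by rw [mul_assoc, hS.inv_mul_cancel, mul_one]
  rw [sub_mul, hS.mul_inv_cancel, sub_mul, mul_sub (R * S⁻¹), h1]
  noncomm_ring

/-- The defect in the variational inequality `2 tr (X^{1/2} A X^{1/2})^{1/2} ≤ tr (T X) + tr (T⁻¹ A)`
as the trace of a positive semidefinite matrix. -/
theorem trace_mul_add_trace_inv_mul_sub {X A T : Matrix m m ℂ} (hX : X.PosDef) (hA : A.PosDef)
    (hT : T.PosDef) :
    (T * X).trace + (T⁻¹ * A).trace - 2 * (CFC.sqrt (CFC.sqrt X * A * CFC.sqrt X)).trace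
      = ((CFC.sqrt X * T * CFC.sqrt X - CFC.sqrt (CFC.sqrt X * A * CFC.sqrt X))
          * (CFC.sqrt X * T * CFC.sqrt X)⁻¹
          * (CFC.sqrt X * T * CFC.sqrt X - CFC.sqrt (CFC.sqrt X * A * CFC.sqrt X))).trace := by
  have hx := hX.posDef_sqrt
  have hxx : CFC.sqrt X * CFC.sqrt X = X :=
    CFC.sqrt_mul_sqrt_self X (nonneg_iff_posSemidef.2 hX.posSemidef)
  have hM := hx.posDef_mul_mul_self hA
  have hRR : CFC.sqrt (CFC.sqrt X * A * CFC.sqrt X) * CFC.sqrt (CFC.sqrt X * A * CFC.sqrt X)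
      = CFC.sqrt X * A * CFC.sqrt X :=
    CFC.sqrt_mul_sqrt_self _ (nonneg_iff_posSemidef.2 hM.posSemidef)
  rw [sub_mul_inv_mul_sub (hx.posDef_mul_mul_self hT)]
  generalize CFC.sqrt (CFC.sqrt X * A * CFC.sqrt X) = R at *
  generalize CFC.sqrt X = x at *
  have h1 : (x * T * x).trace = (T * X).trace := by
    rw [trace_mul_cycle, trace_mul_comm, hxx]
  have h2 : (R * (x * T * x)⁻¹ * R).trace = (T⁻¹ * A).trace := by
    rw [trace_mul_cycle, hRR, mul_inv_rev, mul_inv_rev, trace_mul_comm]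
    calc (x⁻¹ * (T⁻¹ * x⁻¹) * (x * A * x)).trace
        = (x⁻¹ * (T⁻¹ * (x⁻¹ * x) * A * x)).trace := by simp only [mul_assoc]
      _ = (T⁻¹ * A).trace := by
        rw [hx.inv_mul_cancel, trace_mul_comm, mul_one, mul_assoc, hx.mul_inv_cancel, mul_one]
  rw [trace_add, trace_sub, trace_sub, h1, h2]
  ring

/-- The matrix whose trace is the defect vanishes exactly when `T` is optimal, that is
`T X T = A`. -/
theorem defect_eq_zero_iff {X A T : Matrix m m ℂ} (hX : X.PosDef) (hA : A.PosDef)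
    (hT : T.PosDef) :
    (CFC.sqrt X * T * CFC.sqrt X - CFC.sqrt (CFC.sqrt X * A * CFC.sqrt X))
          * (CFC.sqrt X * T * CFC.sqrt X)⁻¹
          * (CFC.sqrt X * T * CFC.sqrt X - CFC.sqrt (CFC.sqrt X * A * CFC.sqrt X)) = 0
      ↔ T * X * T = A := by
  have hx := hX.posDef_sqrt
  have hxx : CFC.sqrt X * CFC.sqrt X = X :=
    CFC.sqrt_mul_sqrt_self X (nonneg_iff_posSemidef.2 hX.posSemidef)
  have hM := hx.posDef_mul_mul_self hA
  have hS := hx.posDef_mul_mul_self hT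
  have hR : (CFC.sqrt (CFC.sqrt X * A * CFC.sqrt X)).IsHermitian := hM.posDef_sqrt.isHermitian
  have hSR : CFC.sqrt (CFC.sqrt X * A * CFC.sqrt X) = CFC.sqrt X * T * CFC.sqrt X
      ↔ T * X * T = A := by
    rw [CFC.sqrt_eq_iff _ _ (nonneg_iff_posSemidef.2 hM.posSemidef)
      (nonneg_iff_posSemidef.2 hS.posSemidef)]
    have h : CFC.sqrt X * T * CFC.sqrt X * (CFC.sqrt X * T * CFC.sqrt X)
        = CFC.sqrt X * (T * X * T) * CFC.sqrt X := by
      calc _ = CFC.sqrt X * (T * (CFC.sqrt X * CFC.sqrt X) * T) * CFC.sqrt X := by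
            simp only [mul_assoc]
        _ = _ := by rw [hxx]
    rw [h]
    refine ⟨fun h => ?_, fun h => by rw [h]⟩
    exact hx.isUnit.mul_left_cancel (hx.isUnit.mul_right_cancel h)
  have hD : (CFC.sqrt X * T * CFC.sqrt X - CFC.sqrt (CFC.sqrt X * A * CFC.sqrt X)).IsHermitian :=
    hS.isHermitian.sub hR
  rw [← hSR, hD.mul_mul_self_eq_zero_iff hS.inv, sub_eq_zero, eq_comm]

end Matrix

/-! ### Affine minorants of the squared distance and the critical point equation -/

open Matrix

section Primal

variable {m : ℕ}

theorem wassersteinDist_sq {X A : Matrix (Fin m) (Fin m) ℂ} (hX : X.PosDef) (hA : A.PosDef) :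
    wassersteinDist X A ^ 2 = (X.trace.re + A.trace.re) / 2
      - (CFC.sqrt (CFC.sqrt X * A * CFC.sqrt X)).trace.re := by
  have h := congrArg Complex.re (trace_mul_add_trace_inv_mul_sub hX hA PosDef.one)
  have h0 := (((hX.posDef_sqrt.posDef_mul_mul_self PosDef.one).isHermitian.sub
    (hX.posDef_sqrt.posDef_mul_mul_self hA).posDef_sqrt.isHermitian).posSemidef_mul_mul_self
    (hX.posDef_sqrt.posDef_mul_mul_self PosDef.one).inv.posSemidef).trace_re_nonneg
  rw [← h] at h0
  have e : (((1 / 2 : ℂ) • (X + A)).trace).re = (X.trace.re + A.trace.re) / 2 := by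
    rw [trace_smul, trace_add, smul_eq_mul, Complex.mul_re]
    norm_num
    ring
  rw [wassersteinDist, Real.sq_sqrt, e]
  rw [e]
  simp at h0
  linarith

/-- The affine minorant of `X ↦ d(X, A)²` attached to `T`. -/
theorem le_wassersteinDist_sq {X A T : Matrix (Fin m) (Fin m) ℂ} (hX : X.PosDef) (hA : A.PosDef)
    (hT : T.PosDef) :
    (X.trace.re + A.trace.re - (T * X).trace.re - (T⁻¹ * A).trace.re) / 2
      ≤ wassersteinDist X A ^ 2 := by
  have h := congrArg Complex.re (trace_mul_add_trace_inv_mul_sub hX hA hT)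
  have h0 := (((hX.posDef_sqrt.posDef_mul_mul_self hT).isHermitian.sub
    (hX.posDef_sqrt.posDef_mul_mul_self hA).posDef_sqrt.isHermitian).posSemidef_mul_mul_self
    (hX.posDef_sqrt.posDef_mul_mul_self hT).inv.posSemidef).trace_re_nonneg
  rw [← h] at h0
  rw [wassersteinDist_sq hX hA]
  simp at h0
  linarith

theorem eq_wassersteinDist_sq_iff {X A T : Matrix (Fin m) (Fin m) ℂ} (hX : X.PosDef)
    (hA : A.PosDef) (hT : T.PosDef) :
    (X.trace.re + A.trace.re - (T * X).trace.re - (T⁻¹ * A).trace.re) / 2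
      = wassersteinDist X A ^ 2 ↔ T * X * T = A := by
  have h := congrArg Complex.re (trace_mul_add_trace_inv_mul_sub hX hA hT)
  have h0 := (((hX.posDef_sqrt.posDef_mul_mul_self hT).isHermitian.sub
    (hX.posDef_sqrt.posDef_mul_mul_self hA).posDef_sqrt.isHermitian).posSemidef_mul_mul_self
    (hX.posDef_sqrt.posDef_mul_mul_self hT).inv.posSemidef).trace_re_eq_zero_iff
  rw [← defect_eq_zero_iff hX hA hT, ← h0, ← h, wassersteinDist_sq hX hA]
  simp
  constructor <;> intro h <;> linarith

variable {n : ℕ} {w : Fin n → ℝ} {A T : Fin n → Matrix (Fin m) (Fin m) ℂ}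
  {X : Matrix (Fin m) (Fin m) ℂ}

/-- Sufficiency of the critical point equation `∑ j, w j • T j = 1`, `T j * X * T j = A j`: summing
the affine minorants, which all touch at `X`, the parts linear in `Y` cancel. -/
theorem isWassersteinMean_iff_eq (hw : ∀ j, 0 < w j) (hsum : ∑ j, w j = 1)
    (hA : ∀ j, (A j).PosDef) (hT : ∀ j, (T j).PosDef) (hT1 : ∑ j, w j • T j = 1)
    (hX : X.PosDef) (hTX : ∀ j, T j * X * T j = A j) (Y : Matrix (Fin m) (Fin m) ℂ) :
    IsWassersteinMean w A Y ↔ Y = X := by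
  set c : ℝ := ∑ j, w j * (((A j).trace.re - ((T j)⁻¹ * A j).trace.re) / 2) with hc
  have key : ∀ Y : Matrix (Fin m) (Fin m) ℂ, ∑ j, w j * ((Y.trace.re + (A j).trace.re
      - (T j * Y).trace.re - ((T j)⁻¹ * A j).trace.re) / 2) = c := by
    intro Y
    have h1 : ∑ j, w j * (T j * Y).trace.re = Y.trace.re := by
      have : (∑ j, (w j • T j) * Y).trace.re = Y.trace.re := by
        rw [← Finset.sum_mul, hT1, one_mul]
      simpa [trace_sum, smul_mul_assoc, trace_smul] using this
    have h2 : ∑ j, w j * Y.trace.re = Y.trace.re := by rw [← Finset.sum_mul, hsum, one_mul]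
    have : ∀ j, w j * ((Y.trace.re + (A j).trace.re
      - (T j * Y).trace.re - ((T j)⁻¹ * A j).trace.re) / 2)
      = w j * (((A j).trace.re - ((T j)⁻¹ * A j).trace.re) / 2)
        + (w j * Y.trace.re - w j * (T j * Y).trace.re) / 2 := fun j => by ring
    rw [Finset.sum_congr rfl fun j _ => this j, Finset.sum_add_distrib, ← Finset.sum_div,
      Finset.sum_sub_distrib, h1, h2]
    simp [hc]
  have hle : ∀ Y : Matrix (Fin m) (Fin m) ℂ, Y.PosDef → c ≤ wassersteinObjective w A Y := by
    intro Y hY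
    rw [← key Y]
    exact Finset.sum_le_sum fun j _ =>
      mul_le_mul_of_nonneg_left (le_wassersteinDist_sq hY (hA j) (hT j)) (hw j).le
  have heq : wassersteinObjective w A X = c := by
    rw [← key X]
    exact Finset.sum_congr rfl fun j _ => by
      rw [(eq_wassersteinDist_sq_iff hX (hA j) (hT j)).2 (hTX j)]
  constructor
  · rintro ⟨hY, hmin⟩
    have h : wassersteinObjective w A Y = c := le_antisymm (heq ▸ hmin X hX) (hle Y hY)
    rw [← key Y] at h
    have hj := (Finset.sum_eq_sum_iff_of_le fun j _ =>
      mul_le_mul_of_nonneg_left (le_wassersteinDist_sq hY (hA j) (hT j)) (hw j).le).1 h.symm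
    -- An empty family of weights would sum to `0`.
    obtain ⟨j⟩ : Nonempty (Fin n) := by
      by_contra hn
      rw [not_nonempty_iff] at hn
      simp at hsum
    have hTY := (eq_wassersteinDist_sq_iff hY (hA j) (hT j)).1
      (mul_left_cancel₀ (hw j).ne' (hj j (Finset.mem_univ j)))
    rw [← hTX j] at hTY
    exact (hT j).isUnit.mul_left_cancel ((hT j).isUnit.mul_right_cancel hTY)
  · rintro rfl
    exact ⟨hX, fun Y hY => heq ▸ hle Y hY⟩

/-- For each `j`, `(A j)⁻¹ + X - 2 • (T j)⁻¹` and `(T j)⁻¹ - (2 - T j)` are the congruences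
`((T j)⁻¹ - X) * X⁻¹ * ((T j)⁻¹ - X)` and `(1 - T j) * (T j)⁻¹ * (1 - T j)`, hence positive
semidefinite; averaging over `j` removes `T j`. -/
theorem two_sub_sum_inv_le (hw : ∀ j, 0 < w j) (hsum : ∑ j, w j = 1)
    (hT : ∀ j, (T j).PosDef) (hT1 : ∑ j, w j • T j = 1)
    (hX : X.PosDef) (hTX : ∀ j, T j * X * T j = A j) :
    (2 : ℝ) • (1 : Matrix (Fin m) (Fin m) ℂ) - ∑ j, w j • (A j)⁻¹ ≤ X := by
  rw [le_iff]
  have h1 : ∀ j, (((T j)⁻¹ - X) * X⁻¹ * ((T j)⁻¹ - X)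
      + (2 : ℝ) • ((1 - T j) * (T j)⁻¹ * (1 - T j))).PosSemidef := fun j =>
    (((hT j).inv.isHermitian.sub hX.isHermitian).posSemidef_mul_mul_self hX.inv.posSemidef).add
    (((isHermitian_one.sub (hT j).isHermitian).posSemidef_mul_mul_self
      (hT j).inv.posSemidef).smul zero_le_two)
  have h2 : ∀ j, ((T j)⁻¹ - X) * X⁻¹ * ((T j)⁻¹ - X)
      + (2 : ℝ) • ((1 - T j) * (T j)⁻¹ * (1 - T j))
      = X + (A j)⁻¹ - (4 : ℝ) • (1 : Matrix (Fin m) (Fin m) ℂ) + (2 : ℝ) • T j := by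
    intro j
    have e1 : ((T j)⁻¹ - X) * X⁻¹ * ((T j)⁻¹ - X)
        = X - (T j)⁻¹ - (T j)⁻¹ + (T j)⁻¹ * X⁻¹ * (T j)⁻¹ := by
      rw [← sub_mul_inv_mul_sub hX]; noncomm_ring
    have e2 : (1 - T j) * (T j)⁻¹ * (1 - T j) = T j - 1 - 1 + 1 * (T j)⁻¹ * 1 := by
      rw [← sub_mul_inv_mul_sub (hT j)]; noncomm_ring
    rw [e1, e2, ← hTX j, Matrix.mul_inv_rev, Matrix.mul_inv_rev, one_mul, mul_one, mul_assoc]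
    module
  have h3 := posSemidef_sum Finset.univ fun j _ => (h1 j).smul (hw j).le
  have h4 : ∑ j, w j • (2 : ℝ) • T j = (2 : ℝ) • (1 : Matrix (Fin m) (Fin m) ℂ) := by
    rw [← hT1, Finset.smul_sum]
    exact Finset.sum_congr rfl fun j _ => smul_comm _ _ _
  have h5 : ∑ j, w j • (((T j)⁻¹ - X) * X⁻¹ * ((T j)⁻¹ - X)
      + (2 : ℝ) • ((1 - T j) * (T j)⁻¹ * (1 - T j)))
      = X - ((2 : ℝ) • (1 : Matrix (Fin m) (Fin m) ℂ) - ∑ j, w j • (A j)⁻¹) := by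
    rw [Finset.sum_congr rfl fun j _ => congrArg (w j • ·) (h2 j)]
    simp only [smul_add, smul_sub, Finset.sum_add_distrib, Finset.sum_sub_distrib,
      ← Finset.sum_smul, hsum, h4]
    module
  rwa [← h5]

end Primal

/-! ### The dual minimization problem -/

section Dual

-- The operator norm makes matrices a C⋆-algebra, so that order bounds become norm bounds.
open scoped Matrix.Norms.L2Operator Topology

namespace Matrix

variable {m : Type*} [Fintype m] [DecidableEq m]

theorem PosSemidef.le_trace_re_smul_one {P : Matrix m m ℂ} (hP : P.PosSemidef) :
    P ≤ P.trace.re • (1 : Matrix m m ℂ) := by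
  have hsa : IsSelfAdjoint P := hP.isHermitian
  rw [← Algebra.algebraMap_eq_smul_one, le_algebraMap_iff_spectrum_le hsa,
    hP.isHermitian.spectrum_real_eq_range_eigenvalues]
  rintro _ ⟨i, rfl⟩
  rw [hP.isHermitian.trace_eq_sum_eigenvalues]
  simp only [Complex.re_sum, Complex.coe_algebraMap, Complex.ofReal_re]
  exact Finset.single_le_sum (fun j _ => hP.eigenvalues_nonneg j) (Finset.mem_univ i)

theorem PosDef.exists_pos_smul_one_le {P : Matrix m m ℂ} (hP : P.PosDef) :
    ∃ a : ℝ, 0 < a ∧ a • (1 : Matrix m m ℂ) ≤ P := by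
  rcases subsingleton_or_nontrivial (Matrix m m ℂ) with h | h
  · exact ⟨1, one_pos, (Subsingleton.elim _ _).le⟩
  · have hsa : IsSelfAdjoint P := hP.isHermitian
    obtain ⟨a, ha, h⟩ := (CFC.exists_pos_algebraMap_le_iff hsa).2
      fun x hx => (isStrictlyPositive_iff_posDef.2 hP).spectrum_pos hx
    exact ⟨a, ha, by rwa [← Algebra.algebraMap_eq_smul_one]⟩

/-- Positive definiteness is an open condition along Hermitian directions. -/
theorem PosDef.eventually_posDef_add_smul {T H : Matrix m m ℂ} (hT : T.PosDef)
    (hH : H.IsHermitian) : ∀ᶠ t : ℝ in 𝓝 0, (T + t • H).PosDef := by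
  obtain ⟨a, ha, haT⟩ := hT.exists_pos_smul_one_le
  have hlim : Filter.Tendsto (fun t : ℝ => ‖t • H‖) (𝓝 0) (𝓝 0) := by
    have : Continuous fun t : ℝ => ‖t • H‖ := by fun_prop
    simpa using this.tendsto 0
  filter_upwards [hlim.eventually_lt_const ha] with t ht
  have hsa : IsSelfAdjoint (t • H) := by
    have hH' : IsSelfAdjoint H := hH
    exact (IsSelfAdjoint.all t).smul hH'
  have h1 := hsa.neg_algebraMap_norm_le_self
  rw [Algebra.algebraMap_eq_smul_one] at h1
  have h2 : (T + t • H - (a • (1 : Matrix m m ℂ) + -(‖t • H‖ • 1))).PosSemidef :=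
    le_iff.1 (add_le_add haT h1)
  have h3 : ((a - ‖t • H‖) • (1 : Matrix m m ℂ)).PosDef := PosDef.one.smul (sub_pos.2 ht)
  convert h3.add_posSemidef h2 using 1
  module

theorem hasDerivAt_trace_inv_add_smul_mul {T : Matrix m m ℂ} (hT : T.PosDef)
    (H A : Matrix m m ℂ) :
    HasDerivAt (fun t : ℝ => ((T + t • H)⁻¹ * A).trace.re) (-(T⁻¹ * A * T⁻¹ * H).trace.re) 0 := by
  obtain ⟨u, hu⟩ := hT.isUnit
  have h0 : HasDerivAt (fun t : ℝ => T + t • H) H 0 := by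
    simpa using ((hasDerivAt_id (0 : ℝ)).smul_const H).const_add T
  have h1 : HasFDerivAt Ring.inverse
      (-((ContinuousLinearMap.mulLeftRight ℝ (Matrix m m ℂ)) T⁻¹) T⁻¹) (T + (0 : ℝ) • H) := by
    have := hasFDerivAt_ringInverse (𝕜 := ℝ) u
    rw [coe_units_inv, hu] at this
    simpa using this
  have h2 := h1.comp_hasDerivAt (0 : ℝ) h0
  let L : Matrix m m ℂ →ₗ[ℝ] ℝ :=
    Complex.reLm ∘ₗ (traceLinearMap m ℝ ℂ) ∘ₗ LinearMap.mulRight ℝ A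
  have h3 := (LinearMap.toContinuousLinearMap L).hasFDerivAt.comp_hasDerivAt (0 : ℝ) h2
  have h4 : (fun t : ℝ => ((T + t • H)⁻¹ * A).trace.re)
      = LinearMap.toContinuousLinearMap L ∘ Ring.inverse ∘ fun t : ℝ => T + t • H := by
    funext t
    simp [L, nonsing_inv_eq_ringInverse]
  have h5 : -(T⁻¹ * A * T⁻¹ * H).trace.re = LinearMap.toContinuousLinearMap L
      ((-((ContinuousLinearMap.mulLeftRight ℝ (Matrix m m ℂ)) T⁻¹) T⁻¹) H) := by
    have : (T⁻¹ * A * T⁻¹ * H).trace = (T⁻¹ * H * T⁻¹ * A).trace := by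
      rw [mul_assoc (T⁻¹ * A), trace_mul_comm, ← mul_assoc]
    simp [L, this, neg_mul]
  rw [h4, h5]
  exact h3

end Matrix

variable {m n : ℕ} {w : Fin n → ℝ} {A : Fin n → Matrix (Fin m) (Fin m) ℂ}

/-- Existence for the dual problem: the functional `∑ j, w j * tr ((T j)⁻¹ * A j)` attains its
minimum over the positive definite `T` with `∑ j, w j • T j = 1`. Its sublevel sets are compact
when described by pairs `(T j, S j)` of positive semidefinite matrices with `T j * S j = 1`. -/
theorem exists_min_sum_trace_inv_mul (hw : ∀ j, 0 < w j) (hsum : ∑ j, w j = 1)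
    (hA : ∀ j, (A j).PosDef) :
    ∃ T : Fin n → Matrix (Fin m) (Fin m) ℂ, (∀ j, (T j).PosDef) ∧ ∑ j, w j • T j = 1 ∧
      ∀ T' : Fin n → Matrix (Fin m) (Fin m) ℂ, (∀ j, (T' j).PosDef) → ∑ j, w j • T' j = 1 →
        ∑ j, w j * ((T j)⁻¹ * A j).trace.re ≤ ∑ j, w j * ((T' j)⁻¹ * A j).trace.re := by
  choose a ha haA using fun j => (hA j).exists_pos_smul_one_le
  set f : (Fin n → Matrix (Fin m) (Fin m) ℂ × Matrix (Fin m) (Fin m) ℂ) → ℝ :=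
    fun p => ∑ j, w j * ((p j).2 * A j).trace.re with hf
  have hfc : Continuous f := by fun_prop
  -- The value of the functional at the feasible point `T = 1`.
  set c : ℝ := ∑ j, w j * (A j).trace.re with hc
  set K : Set (Fin n → Matrix (Fin m) (Fin m) ℂ × Matrix (Fin m) (Fin m) ℂ) :=
    {p | (∀ j, 0 ≤ (p j).1 ∧ 0 ≤ (p j).2 ∧ (p j).1 * (p j).2 = 1) ∧
      ∑ j, w j • (p j).1 = 1 ∧ f p ≤ c} with hK
  have hKclosed : IsClosed K := by
    rw [hK]
    simp only [Set.ofPred_forall, Set.ofPred_and]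
    exact (isClosed_iInter fun j => (isClosed_le continuous_const (by fun_prop)).inter
        ((isClosed_le continuous_const (by fun_prop)).inter
          (isClosed_eq (by fun_prop) continuous_const))).inter
      ((isClosed_eq (by fun_prop) continuous_const).inter (isClosed_le hfc continuous_const))
  have hKsub : K ⊆ Set.univ.pi fun j => Metric.closedBall 0 (w j)⁻¹ ×ˢ
      Metric.closedBall 0 (c / (w j * a j)) := by
    rintro p ⟨hp, hp1, hpc⟩ j -
    have hterm : ∀ k, 0 ≤ w k * ((p k).2 * A k).trace.re := fun k =>
      mul_nonneg (hw k).le ((nonneg_iff_posSemidef.1 (hp k).2.1).trace_mul_re_nonneg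
        (hA k).posSemidef)
    constructor
    · rw [mem_closedBall_zero_iff, CStarAlgebra.norm_le_iff_le_algebraMap _
        (inv_pos.2 (hw j)).le (hp j).1, Algebra.algebraMap_eq_smul_one]
      have h1 : w j • (p j).1 ≤ 1 := hp1 ▸ Finset.single_le_sum
        (fun k _ => smul_nonneg (hw k).le (hp k).1) (Finset.mem_univ j)
      have h2 := smul_le_smul_of_nonneg_left h1 (inv_pos.2 (hw j)).le
      rwa [inv_smul_smul₀ (hw j).ne'] at h2
    · have hS := nonneg_iff_posSemidef.1 (hp j).2.1
      have h1 : w j * ((p j).2 * A j).trace.re ≤ c :=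
        (Finset.single_le_sum (fun k _ => hterm k) (Finset.mem_univ j)).trans hpc
      have h2 : a j * (p j).2.trace.re ≤ ((p j).2 * A j).trace.re := by
        have := hS.trace_mul_re_nonneg (le_iff.1 (haA j))
        simpa [mul_sub, trace_sub, trace_smul] using this
      have h3 : (p j).2.trace.re ≤ c / (w j * a j) := by
        rw [le_div_iff₀ (mul_pos (hw j) (ha j))]
        nlinarith [hw j]
      rw [mem_closedBall_zero_iff, CStarAlgebra.norm_le_iff_le_algebraMap _
        (hS.trace_re_nonneg.trans h3) (hp j).2.1, Algebra.algebraMap_eq_smul_one]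
      exact hS.le_trace_re_smul_one.trans (smul_le_smul_of_nonneg_right h3 zero_le_one)
  have : ProperSpace (Matrix (Fin m) (Fin m) ℂ) := FiniteDimensional.proper ℝ _
  have hKcomp : IsCompact K := (isCompact_univ_pi fun j =>
    (isCompact_closedBall _ _).prod (isCompact_closedBall _ _)).of_isClosed_subset hKclosed hKsub
  have hmem : ∀ T : Fin n → Matrix (Fin m) (Fin m) ℂ, (∀ j, (T j).PosDef) →
      ∑ j, w j • T j = 1 → f (fun j => (T j, (T j)⁻¹)) ≤ c → (fun j => (T j, (T j)⁻¹)) ∈ K :=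
    fun T hT hT1 hTc => ⟨fun j => ⟨nonneg_iff_posSemidef.2 (hT j).posSemidef,
      nonneg_iff_posSemidef.2 (hT j).inv.posSemidef, (hT j).mul_inv_cancel⟩, hT1, hTc⟩
  have hKne : K.Nonempty := ⟨_, hmem (fun _ => 1) (fun _ => PosDef.one)
    (by rw [← Finset.sum_smul, hsum, one_smul]) (by simp [hf, hc])⟩
  obtain ⟨p, ⟨hp, hp1, hpc⟩, hmin⟩ := hKcomp.exists_isMinOn hKne hfc.continuousOn
  have hinv : ∀ j, ((p j).1)⁻¹ = (p j).2 := fun j => inv_eq_right_inv (hp j).2.2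
  refine ⟨fun j => (p j).1, fun j => ?_, hp1, fun T' hT' hT'1 => ?_⟩
  · exact (nonneg_iff_posSemidef.1 (hp j).1).posDef_iff_isUnit.2
      (IsUnit.of_mul_eq_one _ (hp j).2.2)
  · simp only [hinv]
    change f p ≤ f (fun j => (T' j, (T' j)⁻¹))
    rcases le_total (f (fun j => (T' j, (T' j)⁻¹))) c with h | h
    · exact hmin (hmem T' hT' hT'1 h)
    · exact hpc.trans h

/-- Solvability of the critical point equation: at a minimizer `T` of the dual problem the
matrices `(T j)⁻¹ * A j * (T j)⁻¹` agree, being the Lagrange multiplier of the constraint. -/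
theorem exists_critical_point (hw : ∀ j, 0 < w j) (hsum : ∑ j, w j = 1)
    (hA : ∀ j, (A j).PosDef) :
    ∃ (T : Fin n → Matrix (Fin m) (Fin m) ℂ) (X : Matrix (Fin m) (Fin m) ℂ),
      (∀ j, (T j).PosDef) ∧ ∑ j, w j • T j = 1 ∧ X.PosDef ∧ ∀ j, T j * X * T j = A j := by
  obtain ⟨T, hT, hT1, hmin⟩ := exists_min_sum_trace_inv_mul hw hsum hA
  set D : Fin n → Matrix (Fin m) (Fin m) ℂ := fun j => (T j)⁻¹ * A j * (T j)⁻¹ with hD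
  have hDpos : ∀ j, (D j).PosDef := fun j => (hT j).inv.posDef_mul_mul_self (hA j)
  set X : Matrix (Fin m) (Fin m) ℂ := ∑ j, w j • D j with hX
  -- An empty family of weights would sum to `0`.
  obtain ⟨i⟩ : Nonempty (Fin n) := by
    by_contra hn
    rw [not_nonempty_iff] at hn
    simp at hsum
  have hXpos : X.PosDef :=
    posDef_sum ⟨i, Finset.mem_univ i⟩ fun j _ => (hDpos j).smul (hw j)
  -- The direction of perturbation is the deviation of `D` from its weighted average.
  set H : Fin n → Matrix (Fin m) (Fin m) ℂ := fun j => D j - X with hH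
  have hHherm : ∀ j, (H j).IsHermitian := fun j => (hDpos j).isHermitian.sub hXpos.isHermitian
  have hHsum : ∑ j, w j • H j = 0 := by
    simp only [hH, smul_sub, Finset.sum_sub_distrib, ← Finset.sum_smul, hsum, one_smul]
    exact sub_self X
  have hder : HasDerivAt (fun t : ℝ => ∑ j, w j * ((T j + t • H j)⁻¹ * A j).trace.re)
      (∑ j, w j * -(D j * H j).trace.re) 0 :=
    HasDerivAt.fun_sum fun j _ => (hasDerivAt_trace_inv_add_smul_mul (hT j) (H j) (A j)).const_mul _
  have hloc : IsLocalMin (fun t : ℝ => ∑ j, w j * ((T j + t • H j)⁻¹ * A j).trace.re) 0 := by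
    filter_upwards [Filter.eventually_all.2 fun j =>
      (hT j).eventually_posDef_add_smul (hHherm j)] with t ht
    have h1 : ∑ j, w j • (T j + t • H j) = 1 := by
      have h2 : ∑ j, w j • t • H j = 0 := by
        rw [Finset.sum_congr rfl fun j _ => smul_comm (w j) t (H j), ← Finset.smul_sum, hHsum,
          smul_zero]
      simp only [smul_add, Finset.sum_add_distrib, hT1, h2, add_zero]
    simpa using hmin _ ht h1
  have hzero := hloc.hasDerivAt_eq_zero hder
  have hXH : ∑ j, w j * (X * H j).trace.re = 0 := by
    have : (X * ∑ j, w j • H j).trace.re = 0 := by rw [hHsum]; simp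
    simpa [Finset.mul_sum, trace_sum, trace_smul] using this
  have hHpsd : ∀ j, (H j * H j).PosSemidef := fun j => by
    have := posSemidef_self_mul_conjTranspose (H j)
    rwa [(hHherm j).eq] at this
  have hHH : ∑ j, w j * (H j * H j).trace.re = 0 := by
    have h1 : ∀ j, w j * (H j * H j).trace.re
        = -(w j * -(D j * H j).trace.re) - w j * (X * H j).trace.re := fun j => by
      have : (H j * H j).trace.re = (D j * H j).trace.re - (X * H j).trace.re := by
        rw [← Complex.sub_re, ← trace_sub, ← sub_mul]
      rw [this]; ring
    rw [Finset.sum_congr rfl fun j _ => h1 j, Finset.sum_sub_distrib, Finset.sum_neg_distrib,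
      hzero, hXH]
    simp
  have hH0 : ∀ j, D j = X := fun j => by
    have h1 := (Finset.sum_eq_zero_iff_of_nonneg fun k _ =>
      mul_nonneg (hw k).le (hHpsd k).trace_re_nonneg).1 hHH j (Finset.mem_univ j)
    have h2 := (hHpsd j).trace_re_eq_zero_iff.1 ((mul_eq_zero.1 h1).resolve_left (hw j).ne')
    have h3 : H j * (H j)ᴴ = 0 := by rw [(hHherm j).eq, h2]
    exact sub_eq_zero.1 (self_mul_conjTranspose_eq_zero.1 h3)
  refine ⟨T, X, hT, hT1, hXpos, fun j => ?_⟩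
  rw [← hH0 j]
  calc T j * ((T j)⁻¹ * A j * (T j)⁻¹) * T j
      = (T j * (T j)⁻¹) * A j * ((T j)⁻¹ * T j) := by simp only [mul_assoc]
    _ = A j := by rw [(hT j).mul_inv_cancel, (hT j).inv_mul_cancel, one_mul, mul_one]

end Dual

theorem mainTheorem2 {m n : ℕ} (w : Fin n → ℝ) (hw_pos : ∀ j, 0 < w j) (hw_sum : ∑ j, w j = 1)
    (A : Fin n → Matrix (Fin m) (Fin m) ℂ) (hA : ∀ j, (A j).PosDef) :
    (∃! X : Matrix (Fin m) (Fin m) ℂ, IsWassersteinMean w A X) ∧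
      (2 : ℝ) • (1 : Matrix (Fin m) (Fin m) ℂ) - ∑ j, w j • (A j)⁻¹ ≤ wassersteinMean w A := by
  obtain ⟨T, X, hT, hT1, hX, hTX⟩ := exists_critical_point hw_pos hw_sum hA
  have hiff := isWassersteinMean_iff_eq hw_pos hw_sum hA hT hT1 hX hTX
  have hex : ∃ X, IsWassersteinMean w A X := ⟨X, (hiff X).2 rfl⟩
  refine ⟨⟨X, (hiff X).2 rfl, fun Y hY => (hiff Y).1 hY⟩, ?_⟩
  have hmean : wassersteinMean w A = X := by
    rw [wassersteinMean, dif_pos hex]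
    exact (hiff _).1 hex.choose_spec
  rw [hmean]
  exact two_sub_sum_inv_le hw_pos hw_sum hT hT1 hX hTX
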